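/- Let $\mathbb H$ be the upper half-plane, $q=e^{2\pi i\tau}$ for $\tau\in\mathbb H$, and for $k\ge 1$ let $$G_{2k}(\tau)=-\frac{B_{2k}}{(2k)!}+\frac{2}{(2k-1)!}\sum_{n=1}^\infty\frac{n^{2k-1}q^n}{1-q^n},$$ where $B_n$ denotes the $n$-th Bernoulli number. For $h\ge 0$ let $\Theta_h=q\frac{d}{dq}+h\,G_2$, where $q\frac{d}{dq}=\frac{1}{2\pi i}\frac{d}{d\tau}$. For an integer $m\ge 2$ and a function $Q$ of weight $4$ on $\mathbb H$, define functions $R_1,\dots,R_m$ on $\mathbb H$ by $$R_1=mQ,\qquad R_2=m\,\Theta_4 Q,\qquad R_{i+1}=\Theta_{2i+2}R_i+(i+1)(m-i)\,Q\,R_{i-1}\quad(2\le i\le m-1).$$ (The function $R_i$ has weight $2i+2$, so each $\Theta_h$ is applied to a function of weight $h$.) Let $m=12$, $\lambda\in\mathbb C$ and $Q=\lambda G_4$. Then $R_{12}$ vanishes identically on $\mathbb H$ if and only if $$\lambda\in\left\{-\tfrac{11}{5},\,-\tfrac{25}{4},\,-15,\,-40,\,0\right\}.$$ -/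

import Mathlib

open UpperHalfPlane

noncomputable section

namespace SymPowRecursion

/-- The nome `q = exp (2 π i τ)`. -/
def nome (τ : ℍ) : ℂ := Complex.exp (2 * Real.pi * Complex.I * (τ : ℂ))

/-- `eisG k` is the Eisenstein series `G_{2k}` (so `eisG 1 = G_2`, `eisG 2 = G_4`):
`G_{2k}(τ) = -B_{2k} / (2k)! + 2 / (2k-1)! * ∑_{n ≥ 1} n^{2k-1} q^n / (1 - q^n)`, for `k ≥ 1`. -/
def eisG (k : ℕ) (τ : ℍ) : ℂ :=
  -(bernoulli (2 * k) : ℂ) / (Nat.factorial (2 * k) : ℂ) +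
    2 / (Nat.factorial (2 * k - 1) : ℂ) *
      ∑' n : ℕ+, ((n : ℕ) : ℂ) ^ (2 * k - 1) * nome τ ^ (n : ℕ) / (1 - nome τ ^ (n : ℕ))

/-- The operator `Θ_h = q d/dq + h G_2`, acting on functions of weight `h`;
`Derivative.normalizedDerivOfComplex` is `q d/dq = (2 π i)⁻¹ d/dτ`. -/
def theta (h : ℕ) (f : ℍ → ℂ) (τ : ℍ) : ℂ :=
  Derivative.normalizedDerivOfComplex f τ + (h : ℂ) * eisG 1 τ * f τ

/-- The sequence `R_1, R_2, …` attached to `m` and to a function `Q` of weight `4`: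
`R_1 = m Q`, `R_2 = m Θ Q`, `R_{i+1} = Θ R_i + (i+1) (m-i) Q R_{i-1}` for `i ≥ 2`
(the last clause is the case `i = n + 2`). The function `R_i` has weight `2 i + 2`, so that `Θ`
acts on it as `Θ_{2i+2}`, and on `Q` as `Θ_4`. The value at the index `0` is not used. -/
def recR (m : ℕ) (Q : ℍ → ℂ) : ℕ → ℍ → ℂ
  | 0 => 0
  | 1 => fun τ => (m : ℂ) * Q τ
  | 2 => fun τ => (m : ℂ) * theta 4 Q τ
  | n + 3 => fun τ =>
      theta (2 * (n + 2) + 2) (recR m Q (n + 2)) τ +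
        (((n + 2 : ℕ) : ℂ) + 1) * ((m : ℂ) - ((n + 2 : ℕ) : ℂ)) * Q τ * recR m Q (n + 1) τ

end SymPowRecursion

end

open UpperHalfPlane ModularForm EisensteinSeries Derivative Filter Topology
open scoped Manifold MatrixGroups

/-! Since `G_2 = -E2/12`, the operator `Θ_h` is the Serre derivative, and Ramanujan's formulas give
`Θ E₄ = -E₆/3` and `Θ E₆ = -E₄²/2`. By Leibniz, `Θ` preserves `ℂ[E₄, E₆]`, so with `Q` a multiple of
`E₄` every `R_i` is an explicit polynomial in `E₄`, `E₆` and `λ`. `R_12` has weight 26, hence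
involves only `E₄²E₆³` and `E₄⁵E₆`. Their coefficients share a quintic in `λ` whose roots are the
five listed values (`recR_twelve`), and the remaining factor is never identically zero
(`linear_combination_E4_E6_ne_zero`). -/

namespace SymPowRecursion

/-! ### Behaviour at the cusp -/

section Limits

/-- A holomorphic function on `ℍ` given by a `q`-expansion tends to its constant term at `i∞`,
and its normalized derivative tends to `0`. -/
theorem tendsto_atImInfty_of_hasSum {f : ℍ → ℂ} {c : ℕ → ℂ} (hol : MDiff f)
    (hf : ∀ τ : ℍ, HasSum (fun m ↦ c m • Function.Periodic.qParam 1 τ ^ m) (f τ)) :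
    Tendsto f atImInfty (𝓝 (c 0)) ∧
      Tendsto (normalizedDerivOfComplex f) atImInfty (𝓝 0) := by
  have hper : Function.Periodic (f ∘ ofComplex) ((1 : ℝ) : ℂ) := by
    intro w
    by_cases! hw : 0 < w.im
    · have hw' : 0 < (w + ((1 : ℝ) : ℂ)).im := by simpa using hw
      simp only [Function.comp_apply, ofComplex_apply_of_im_pos hw, ofComplex_apply_of_im_pos hw']
      have h1 := hf ⟨w + ((1 : ℝ) : ℂ), hw'⟩
      have h2 := hf ⟨w, hw⟩
      have hq : Function.Periodic.qParam 1 (w + ((1 : ℝ) : ℂ)) = Function.Periodic.qParam 1 w :=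
        by
        simp [Function.Periodic.qParam, mul_add, Complex.exp_add]
      simp only [hq] at h1
      exact h1.unique h2
    -- Off the half-plane `ofComplex` is constant, so periodicity is trivial there.
    · have hw' : (w + ((1 : ℝ) : ℂ)).im ≤ 0 := by simpa using hw
      simp only [Function.comp_apply, ofComplex_apply_of_im_nonpos hw,
        ofComplex_apply_of_im_nonpos hw']
  have hbdd := isBoundedAtImInfty_of_hasSum_qExpansion one_pos hf
  have han := analyticAt_cuspFunction_zero one_pos hper hol hbdd
  have hq := qParam_tendsto_atImInfty one_pos
  have heq : ∀ τ : ℍ, cuspFunction 1 f (Function.Periodic.qParam 1 τ) = f τ := fun τ ↦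
    eq_cuspFunction τ one_ne_zero hper
  constructor
  · have h0 : cuspFunction 1 f 0 = c 0 := by
      have := (hasFPowerSeriesOnBall_cuspFunction one_pos han hf).coeff_zero (fun _ ↦ 1)
      simpa using this.symm
    have := han.continuousAt.tendsto.comp hq
    rw [h0] at this
    exact this.congr heq
  -- By the chain rule `q d/dq` of `F(q)` is `q F'(q)`, and the factor `q` tends to 0.
  · have hD : ∀ τ : ℍ, normalizedDerivOfComplex f τ = Function.Periodic.qParam 1 τ *
        deriv (cuspFunction 1 f) (Function.Periodic.qParam 1 τ) := by
      intro τ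
      have hev : f ∘ ofComplex =ᶠ[𝓝 (τ : ℂ)]
          cuspFunction 1 f ∘ fun z ↦ Function.Periodic.qParam 1 z := by
        filter_upwards [isOpen_upperHalfPlaneSet.mem_nhds τ.im_pos] with w hw
        simp only [Function.comp_apply, ofComplex_apply_of_im_pos hw]
        exact (heq ⟨w, hw⟩).symm
      have hdq : HasDerivAt (fun z ↦ Function.Periodic.qParam 1 z)
          (2 * Real.pi * Complex.I * Function.Periodic.qParam 1 τ) (τ : ℂ) := by
        have h := ((hasDerivAt_id (τ : ℂ)).const_mul (2 * Real.pi * Complex.I)).cexp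
        simpa [Function.Periodic.qParam, mul_comm] using h
      have hdc := (differentiableAt_cuspFunction one_pos hper hol hbdd
        (q := Function.Periodic.qParam 1 τ)
        (Function.Periodic.norm_qParam_lt_one one_pos τ.im_pos)).hasDerivAt
      rw [normalizedDerivOfComplex, hev.deriv_eq, (hdc.comp (τ : ℂ) hdq).deriv]
      have : (2 * Real.pi * Complex.I : ℂ) ≠ 0 := Complex.two_pi_I_ne_zero
      field_simp
    have := hq.mul (han.deriv.continuousAt.tendsto.comp hq)
    rw [zero_mul] at this
    exact this.congr fun τ ↦ (hD τ).symm

theorem tendsto_E2_atImInfty : Tendsto E2 atImInfty (𝓝 1) := by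
  have := (tendsto_atImInfty_of_hasSum E2_mdifferentiable fun τ ↦ by
    simpa only [Function.Periodic.qParam, Complex.ofReal_one, div_one]
      using hasSum_qExpansion_E2 (z := τ)).1
  rwa [if_pos rfl] at this

theorem tendsto_modularForm_atImInfty {k : ℤ} (f : ModularForm 𝒮ℒ k) :
    Tendsto f atImInfty (𝓝 ((qExpansion 1 f).coeff 0)) ∧
      Tendsto (normalizedDerivOfComplex f) atImInfty (𝓝 0) :=
  tendsto_atImInfty_of_hasSum (f := f) f.holo' fun τ ↦
    ModularForm.hasSum_qExpansion (f := f) one_pos one_mem_strictPeriods_SL τ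

theorem tendsto_E4_atImInfty : Tendsto E₄ atImInfty (𝓝 1) := by
  simpa only [E_qExpansion_coeff_zero _ (⟨2, rfl⟩ : Even 4)] using
    (tendsto_modularForm_atImInfty E₄).1

theorem tendsto_E6_atImInfty : Tendsto E₆ atImInfty (𝓝 1) := by
  simpa only [E_qExpansion_coeff_zero _ (⟨3, rfl⟩ : Even 6)] using
    (tendsto_modularForm_atImInfty E₆).1

end Limits

/-! ### Ramanujan's differential equations -/

section Ramanujan

/-- The derivative dies at the cusp and `E2` tends to 1, so only the `-(k/12) E2 f` term
contributes. -/
theorem tendsto_serreDerivative_atImInfty {k : ℤ} (f : ModularForm 𝒮ℒ k) :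
    Tendsto (serreDerivative k f) atImInfty (𝓝 (-(k / 12) * (qExpansion 1 f).coeff 0)) := by
  obtain ⟨h1, h2⟩ := tendsto_modularForm_atImInfty f
  have := h2.sub ((tendsto_E2_atImInfty.const_mul (k * 12⁻¹ : ℂ)).mul h1)
  rw [show -(k / 12 : ℂ) * (qExpansion 1 f).coeff 0 =
    0 - k * 12⁻¹ * 1 * (qExpansion 1 f).coeff 0 by ring]
  exact this

/-- The Serre derivative as a map on level one modular forms. -/
noncomputable def serreDerivativeForm {k : ℤ} (f : ModularForm 𝒮ℒ k) : ModularForm 𝒮ℒ (k + 2) where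
  toFun := serreDerivative k f
  slash_action_eq' A hA := by
    obtain ⟨γ, rfl⟩ := hA
    exact serreDerivative_slash_invariant f.holo' (γ := γ) (f.slash_action_eq' _ ⟨γ, rfl⟩)
  holo' := serreDerivative_mdifferentiable _ f.holo'
  bdd_at_cusps' {c} hc := by
    rw [OnePoint.isBoundedAt_iff_forall_SL2Z hc]
    intro γ _
    have h := serreDerivative_slash_invariant f.holo' (γ := γ) (f.slash_action_eq' _ ⟨γ, rfl⟩)
    have hb : IsBoundedAtImInfty (serreDerivative k f) :=
      (tendsto_serreDerivative_atImInfty f).isBigO_one ℝ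
    exact h.symm ▸ hb

/-- A modular form in a one-dimensional space is determined by its value at `i∞`. -/
theorem eq_smul_of_rank_eq_one {k : ℤ} (hk : Module.rank ℂ (ModularForm 𝒮ℒ k) = 1)
    {f g : ModularForm 𝒮ℒ k} {c : ℂ} (hf : Tendsto f atImInfty (𝓝 c))
    (hg : Tendsto g atImInfty (𝓝 1)) : f = c • g := by
  have hg0 : g ≠ 0 := by
    rintro rfl
    exact one_ne_zero (tendsto_nhds_unique hg (tendsto_const_nhds (x := (0 : ℂ))))
  obtain ⟨d, rfl⟩ := (finrank_eq_one_iff_of_nonzero' g hg0).mp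
    (Module.rank_eq_one_iff_finrank_eq_one.mp hk) f
  have : Tendsto (d • g : ModularForm 𝒮ℒ k) atImInfty (𝓝 (d * 1)) := hg.const_mul d
  rw [tendsto_nhds_unique hf this, mul_one]

/-- Ramanujan's formula for the derivative of `E₄`. -/
theorem normalizedDeriv_E4 (τ : ℍ) :
    normalizedDerivOfComplex E₄ τ = (E2 τ * E₄ τ - E₆ τ) / 3 := by
  have hlim : Tendsto (serreDerivativeForm E₄) atImInfty (𝓝 (-(1 / 3))) := by
    have := tendsto_serreDerivative_atImInfty E₄
    rw [E_qExpansion_coeff_zero _ (⟨2, rfl⟩ : Even 4),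
      show -(((4 : ℤ) : ℂ) / 12) * 1 = -(1 / 3) by norm_num] at this
    exact this
  have h := DFunLike.congr_fun (eq_smul_of_rank_eq_one levelOne_weight_six_rank_one
    (f := serreDerivativeForm E₄) (g := E₆) hlim tendsto_E6_atImInfty) τ
  have h' : normalizedDerivOfComplex E₄ τ - ((4 : ℤ) : ℂ) * 12⁻¹ * E2 τ * E₄ τ
      = -(1 / 3) * E₆ τ := h
  push_cast at h'
  linear_combination h'

/-- Ramanujan's formula for the derivative of `E₆`. -/
theorem normalizedDeriv_E6 (τ : ℍ) :
    normalizedDerivOfComplex E₆ τ = (E2 τ * E₆ τ - E₄ τ ^ 2) / 2 := by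
  have hlim : Tendsto (serreDerivativeForm E₆) atImInfty (𝓝 (-(1 / 2))) := by
    have := tendsto_serreDerivative_atImInfty E₆
    rw [E_qExpansion_coeff_zero _ (⟨3, rfl⟩ : Even 6),
      show -(((6 : ℤ) : ℂ) / 12) * 1 = -(1 / 2) by norm_num] at this
    exact this
  -- Weight 8 is one-dimensional, spanned by `E₄²`.
  have hrank : Module.rank ℂ (ModularForm 𝒮ℒ (6 + 2)) = 1 := by
    have := dimension_level_one 8 ⟨4, rfl⟩
    simpa [Nat.ModEq] using this
  have hg : Tendsto (E₄.mul E₄) atImInfty (𝓝 1) := by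
    have := tendsto_E4_atImInfty.mul tendsto_E4_atImInfty
    rwa [mul_one] at this
  have h := DFunLike.congr_fun (eq_smul_of_rank_eq_one hrank
    (f := serreDerivativeForm E₆) (g := E₄.mul E₄) hlim hg) τ
  have h' : normalizedDerivOfComplex E₆ τ - ((6 : ℤ) : ℂ) * 12⁻¹ * E2 τ * E₆ τ
      = -(1 / 2) * (E₄ τ * E₄ τ) := h
  push_cast at h'
  linear_combination h'

end Ramanujan

/-! ### `G_2` and `G_4` via Lambert series -/

section EisensteinNormalization

theorem eisG_one (τ : ℍ) : eisG 1 τ = -(E2 τ) / 12 := by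
  have hs := tsum_pow_div_one_sub_eq_tsum_sigma (norm_exp_two_pi_I_lt_one τ) 1
  rw [E2_eq_tsum_cexp, eisG, nome, ← hs]
  norm_num [bernoulli_two]
  ring

theorem eisG_two (τ : ℍ) : eisG 2 τ = E₄ τ / 720 := by
  have hs := tsum_pow_div_one_sub_eq_tsum_sigma (norm_exp_two_pi_I_lt_one τ) 3
  have hE := q_expansion_bernoulli (by norm_num : 3 ≤ 4) ⟨2, rfl⟩ τ
  have hb : bernoulli 4 = -1 / 30 := by decide +kernel
  simp only [zpow_natCast, Nat.add_one_sub_one] at hE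
  rw [hE, eisG, nome, hs, hb]
  norm_num [hb, Nat.factorial]
  ring

end EisensteinNormalization

/-! ### The recursion in `ℂ[E₄, E₆]` -/

section Recursion

/-- The monomial `E₄ ^ a * E₆ ^ b`. -/
noncomputable def eisMonomial (a b : ℕ) (τ : ℍ) : ℂ := E₄ τ ^ a * E₆ τ ^ b

/-- `f` is holomorphic and `Θ_h f = g`. -/
def HasTheta (h : ℕ) (f g : ℍ → ℂ) : Prop := MDiff f ∧ theta h f = g

theorem HasTheta.add {h : ℕ} {f₁ f₂ g₁ g₂ : ℍ → ℂ} (h₁ : HasTheta h f₁ g₁)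
    (h₂ : HasTheta h f₂ g₂) : HasTheta h (f₁ + f₂) (g₁ + g₂) := by
  refine ⟨h₁.1.add h₂.1, ?_⟩
  rw [← h₁.2, ← h₂.2]
  funext τ
  simp only [theta, normalizedDerivOfComplex_add _ _ h₁.1 h₂.1, Pi.add_apply]
  ring

theorem HasTheta.smul {h : ℕ} {f g : ℍ → ℂ} (c : ℂ) (hf : HasTheta h f g) :
    HasTheta h (c • f) (c • g) := by
  refine ⟨hf.1.const_smul c, ?_⟩
  rw [← hf.2]
  funext τ
  simp only [theta, normalizedDerivOfComplex_smul _ _ hf.1, Pi.smul_apply, smul_eq_mul]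
  ring

/-- The `E2` terms from Ramanujan's formulas sum to `(4a + 6b)/12`, which `h G_2` cancels. When `a =
0` or `b = 0`, the truncated exponent comes with coefficient 0. -/
theorem hasTheta_eisMonomial (a b : ℕ) :
    HasTheta (4 * a + 6 * b) (eisMonomial a b) (fun τ ↦
      -(a / 3 : ℂ) * eisMonomial (a - 1) (b + 1) τ
        - (b / 2 : ℂ) * eisMonomial (a + 2) (b - 1) τ) := by
  have h4 : MDiff (E₄ : ℍ → ℂ) := E₄.holo'
  have h6 : MDiff (E₆ : ℍ → ℂ) := E₆.holo'
  have hfun : eisMonomial a b = (E₄ : ℍ → ℂ) ^ a * (E₆ : ℍ → ℂ) ^ b := rfl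
  refine ⟨hfun ▸ (h4.pow a).mul (h6.pow b), ?_⟩
  funext τ
  rw [theta, hfun, normalizedDerivOfComplex_mul _ _ (h4.pow a) (h6.pow b),
    normalizedDerivOfComplex_pow _ _ h4, normalizedDerivOfComplex_pow _ _ h6, eisG_one]
  simp only [Pi.add_apply, Pi.mul_apply, Pi.pow_apply, Pi.natCast_apply, normalizedDeriv_E4,
    normalizedDeriv_E6, eisMonomial]
  cases a <;> cases b <;> simp <;> ring

/-- The function `λ G₄`. -/
noncomputable def eisQ (lam : ℂ) (τ : ℍ) : ℂ := lam * eisG 2 τ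

theorem eisQ_eq (lam : ℂ) : eisQ lam = (lam / 720) • eisMonomial 1 0 := by
  funext τ
  simp only [eisQ, eisG_two, eisMonomial, Pi.smul_apply, smul_eq_mul]
  ring

theorem recR_add_three {m n : ℕ} {lam : ℂ} {f g f' : ℍ → ℂ}
    (hf : recR m (eisQ lam) (n + 2) = f) (hg : recR m (eisQ lam) (n + 1) = g)
    (hθ : HasTheta (2 * (n + 2) + 2) f f') (τ : ℍ) :
    recR m (eisQ lam) (n + 3) τ =
      f' τ + (n + 3) * (m - (n + 2)) * (lam / 720 * eisMonomial 1 0 τ) * g τ := by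
  rw [recR, hf, hg, hθ.2, eisQ_eq]
  simp only [Pi.smul_apply, smul_eq_mul]
  push_cast
  ring

variable (lam : ℂ)

theorem recR_one : recR 12 (eisQ lam) 1 = (lam / 60) • eisMonomial 1 0 := by
  funext τ
  rw [recR, eisQ_eq]
  simp only [Pi.smul_apply, smul_eq_mul]
  push_cast
  ring

theorem recR_two : recR 12 (eisQ lam) 2 = (-lam / 180) • eisMonomial 0 1 := by
  funext τ
  rw [recR, eisQ_eq, ((hasTheta_eisMonomial 1 0).smul (lam / 720)).2]
  simp only [Pi.smul_apply, smul_eq_mul]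
  norm_num
  ring

theorem recR_three : recR 12 (eisQ lam) 3 =
      (lam * (4 + lam) / 1440) • eisMonomial 2 0 := by
  funext τ
  rw [recR_add_three (recR_two lam) (recR_one lam)
    ((hasTheta_eisMonomial 0 1).smul _)]
  simp only [Pi.smul_apply, smul_eq_mul, eisMonomial]
  norm_num
  ring

theorem recR_four : recR 12 (eisQ lam) 4 =
      (lam * (-5 - 2 * lam) / 2700) • eisMonomial 1 1 := by
  funext τ
  rw [recR_add_three (recR_three lam) (recR_two lam)
    ((hasTheta_eisMonomial 2 0).smul _)]
  simp only [Pi.smul_apply, smul_eq_mul, eisMonomial]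
  norm_num
  ring

theorem recR_five : recR 12 (eisQ lam) 5 =
      (lam * (5 + 2 * lam) / 8100) • eisMonomial 0 2 +
      (lam * (120 + 68 * lam + 5 * lam ^ 2) / 129600) • eisMonomial 3 0 := by
  funext τ
  rw [recR_add_three (recR_four lam) (recR_three lam)
    ((hasTheta_eisMonomial 1 1).smul _)]
  simp only [Pi.add_apply, Pi.smul_apply, smul_eq_mul, eisMonomial]
  norm_num
  ring

theorem recR_six : recR 12 (eisQ lam) 6 =
      (lam * (-1000 - 570 * lam - 53 * lam ^ 2) / 648000) • eisMonomial 2 1 := by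
  funext τ
  rw [recR_add_three (recR_five lam) (recR_four lam)
    (((hasTheta_eisMonomial 0 2).smul _).add
      ((hasTheta_eisMonomial 3 0).smul _))]
  simp only [Pi.add_apply, Pi.smul_apply, smul_eq_mul, eisMonomial]
  norm_num
  ring

theorem recR_seven : recR 12 (eisQ lam) 7 =
      (lam * (1000 + 605 * lam + 67 * lam ^ 2) / 972000) • eisMonomial 1 2 +
      (lam * (12000 + 7680 * lam + 1112 * lam ^ 2 +
          35 * lam ^ 3) / 15552000) • eisMonomial 4 0 := by
  funext τ
  rw [recR_add_three (recR_six lam) (recR_five lam)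
    ((hasTheta_eisMonomial 2 1).smul _)]
  simp only [Pi.add_apply, Pi.smul_apply, smul_eq_mul, eisMonomial]
  norm_num
  ring

theorem recR_eight : recR 12 (eisQ lam) 8 =
      (lam * (-1000 - 605 * lam - 67 * lam ^ 2) / 2916000) • eisMonomial 0 3 +
      (lam * (-12000 - 7970 * lam - 1243 * lam ^ 2 -
          44 * lam ^ 3) / 5832000) • eisMonomial 3 1 := by
  funext τ
  rw [recR_add_three (recR_seven lam) (recR_six lam)
    (((hasTheta_eisMonomial 1 2).smul _).add
      ((hasTheta_eisMonomial 4 0).smul _))]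
  simp only [Pi.add_apply, Pi.smul_apply, smul_eq_mul, eisMonomial]
  norm_num
  ring

theorem recR_nine : recR 12 (eisQ lam) 9 =
      (lam * (150000 + 100850 * lam + 16255 * lam ^ 2 +
          641 * lam ^ 3) / 58320000) • eisMonomial 2 2 +
      (lam * (960000 + 673600 * lam + 122480 * lam ^ 2 + 6856 * lam ^ 3 +
          105 * lam ^ 4) / 933120000) • eisMonomial 5 0 := by
  funext τ
  rw [recR_add_three (recR_eight lam) (recR_seven lam)
    (((hasTheta_eisMonomial 0 3).smul _).add
      ((hasTheta_eisMonomial 3 1).smul _))]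
  simp only [Pi.add_apply, Pi.smul_apply, smul_eq_mul, eisMonomial]
  norm_num
  ring

theorem recR_ten : recR 12 (eisQ lam) 10 =
      (lam * (-600000 - 408400 * lam - 68045 * lam ^ 2 -
          2899 * lam ^ 3) / 349920000) • eisMonomial 1 3 +
      (lam * (-12000000 - 8448800 * lam - 1552040 * lam ^ 2 - 89908 * lam ^ 3 -
          1405 * lam ^ 4) / 2799360000) • eisMonomial 4 1 := by
  funext τ
  rw [recR_add_three (recR_nine lam) (recR_eight lam)
    (((hasTheta_eisMonomial 2 2).smul _).add
      ((hasTheta_eisMonomial 5 0).smul _))]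
  simp only [Pi.add_apply, Pi.smul_apply, smul_eq_mul, eisMonomial]
  norm_num
  ring

theorem recR_eleven : recR 12 (eisQ lam) 11 =
      (lam * (600000 + 408400 * lam + 68045 * lam ^ 2 +
          2899 * lam ^ 3) / 1049760000) • eisMonomial 0 4 +
      (lam * (174000000 + 122894000 * lam + 22753800 * lam ^ 2 + 1338795 * lam ^ 3 +
          21101 * lam ^ 4) / 20995200000) • eisMonomial 3 2 +
      (lam * (720000000 + 517488000 * lam + 100532000 * lam ^ 2 + 6741760 * lam ^ 3 +
          159716 * lam ^ 4 + 1155 * lam ^ 5) / 335923200000) • eisMonomial 6 0 := by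
  funext τ
  rw [recR_add_three (recR_ten lam) (recR_nine lam)
    (((hasTheta_eisMonomial 1 3).smul _).add
      ((hasTheta_eisMonomial 4 1).smul _))]
  simp only [Pi.add_apply, Pi.smul_apply, smul_eq_mul, eisMonomial]
  norm_num
  ring

theorem recR_twelve : recR 12 (eisQ lam) 12 =
      (-lam * (lam + 11 / 5) * (lam + 25 / 4) * (lam + 15) * (lam + 40) / 65610000) •
      ((75 : ℂ) • eisMonomial 2 3 + (lam + 100) • eisMonomial 5 1) := by
  funext τ
  rw [recR_add_three (recR_eleven lam) (recR_ten lam)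
    ((((hasTheta_eisMonomial 0 4).smul _).add
      ((hasTheta_eisMonomial 3 2).smul _)).add
      ((hasTheta_eisMonomial 6 0).smul _))]
  simp only [Pi.add_apply, Pi.smul_apply, smul_eq_mul, eisMonomial]
  norm_num
  ring

end Recursion

/-! ### Nonvanishing of the residual factor -/

section Vanishing

/-- The limit at the cusp is `75 + c`, forcing `c = -75`. The combination is then `-75 · 1728 · Δ
E₄² E₆`, but `Δ` has no zeros and `E₄² E₆` tends to 1. -/
theorem linear_combination_E4_E6_ne_zero (c : ℂ) :
    (75 : ℂ) • eisMonomial 2 3 + c • eisMonomial 5 1 ≠ 0 := by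
  intro h
  have h4 := tendsto_E4_atImInfty
  have h6 := tendsto_E6_atImInfty
  have hlim := (((h4.pow 2).mul (h6.pow 3)).const_mul 75).add
    (((h4.pow 5).mul (h6.pow 1)).const_mul c)
  have hc : (75 : ℂ) * (1 ^ 2 * 1 ^ 3) + c * (1 ^ 5 * 1 ^ 1) = 0 :=
    tendsto_nhds_unique hlim (tendsto_const_nhds.congr fun τ ↦ (congrFun h τ).symm)
  obtain rfl : c = -75 := by linear_combination hc
  have hzero : ∀ τ : ℍ, E₄ τ ^ 2 * E₆ τ = 0 := by
    intro τ
    have hτ : (75 : ℂ) * (E₄ τ ^ 2 * E₆ τ ^ 3) + -75 * (E₄ τ ^ 5 * E₆ τ ^ 1) = 0 := congrFun h τ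
    have hΔ := discriminant_ne_zero τ
    have hmul : ModularForm.discriminant τ * (E₄ τ ^ 2 * E₆ τ) = 0 := by
      rw [discriminant_eq_E₄_cube_sub_E₆_sq]
      linear_combination -hτ / (75 * 1728)
    exact (mul_eq_zero.mp hmul).resolve_left hΔ
  have h1 : (1 : ℂ) ^ 2 * 1 = 0 :=
    tendsto_nhds_unique ((h4.pow 2).mul h6) (tendsto_const_nhds.congr fun τ ↦ (hzero τ).symm)
  norm_num at h1

end Vanishing

end SymPowRecursion

theorem lemma5p2 (lam : ℂ) :
    SymPowRecursion.recR 12 (fun τ : UpperHalfPlane => lam * SymPowRecursion.eisG 2 τ) 12 = 0 ↔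
      lam ∈ ({-11 / 5, -25 / 4, -15, -40, 0} : Set ℂ) := by
  have h := SymPowRecursion.recR_twelve lam
  unfold SymPowRecursion.eisQ at h
  rw [h, smul_eq_zero, or_iff_left (SymPowRecursion.linear_combination_E4_E6_ne_zero _)]
  simp only [div_eq_zero_iff, mul_eq_zero, neg_eq_zero, add_eq_zero_iff_eq_neg,
    Set.mem_insert_iff, Set.mem_singleton_iff, neg_div]
  norm_num
  tauto
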